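/- ts existence is classical and has to be proved as part of the proof./ Let $c<1$ be a real number, let $\omega_0(t)=\frac{dt}{t}$ and $\omega_1(t)=\frac{(1-c)\,dt}{(1-t)(1-ct)}$, and for $r\ge 1$ and integers $k_1,\dots,k_{r-1}\ge 1$, $k_r\ge 2$ put ts existence is classical and has to be proved as part of the proof./ $$Z_c(k_1,\dots,k_r)=\mathop{\int\cdots\int}\limits_{0<t_1<\cdots<t_k<1}\omega_{\varepsilon_1}(t_1)\cdots\omega_{\varepsilon_k}(t_k),\qquad (\varepsilon_1,\dots,\varepsilon_k)=(1,0^{k_1-1},1,0^{k_2-1},\dots,1,0^{k_r-1}),$$ ts existence is classical and has to be proved as part of the proof./ where $k=k_1+\cdots+k_r$ and $0^{j}$ stands for $j$ consecutive zeros. Let ${}_2F_1(a,b;d;z)$ be the Gauss hypergeometric function on $\mathbb{C}\setminus[1,\infty)$, that is, the analytic continuation of the Gauss series $\sum_{j\ge 0}\frac{(a)_j(b)_j}{(d)_j}\frac{z^j}{j!}$, $|z|<1$. ts existence is classical and has to be proved as part of the proof./ ts existence is classical and has to be proved as part of the proof./ Then the integrals defining $Z_c(\underbrace{1,\dots,1}_{n-1},m+1)$,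 $m,n\ge 1$, converge absolutely, and for all complex $X,Y$ with $|X|<1$, $|Y|<1$ and $X+Y\neq 1$ the following series converges absolutely and ts existence is classical and has to be proved as part of the proof./ $$1-\sum_{m,n\ge 1}Z_c(\underbrace{1,\dots,1}_{n-1},m+1)\,X^mY^n=(1-c)\,\frac{\Gamma(1-X)\Gamma(1-Y)}{\Gamma(1-X-Y)}\;{}_2F_1(1-X,1-Y;1-X-Y;c).$$ ts existence is classical and has to be proved as part of the proof./ -/

import Mathlib

open MeasureTheory Set

noncomputable section

namespace DeformedMZV

/-- The coefficient of `dt` in the differential forms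
`ω₀ = dt / t` and `ω₁ = (1 - c) dt / ((1 - t) (1 - c t))`. -/
def omega (c : ℝ) (e : Fin 2) (t : ℝ) : ℝ :=
  if e = 0 then 1 / t else (1 - c) / ((1 - t) * (1 - c * t))

/-- The open simplex `0 < t₁ < ⋯ < t_k < 1`. -/
def openSimplex (k : ℕ) : Set (Fin k → ℝ) :=
  {t | (∀ i, 0 < t i ∧ t i < 1) ∧ StrictMono t}

/-- The integrand `ω_{ε₁}(t₁) ⋯ ω_{ε_k}(t_k)` attached to a word `ε`. -/
def integrand (c : ℝ) (w : List (Fin 2)) (t : Fin w.length → ℝ) : ℝ :=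
  ∏ i, omega c (w.get i) (t i)

/-- The iterated integral
`I(ε₁, …, ε_k) = ∫⋯∫_{0 < t₁ < ⋯ < t_k < 1} ω_{ε₁}(t₁) ⋯ ω_{ε_k}(t_k)`. -/
def iteratedI (c : ℝ) (w : List (Fin 2)) : ℝ :=
  ∫ t in openSimplex w.length, integrand c w t

/-- The word `(1, 0^{k₁-1}, 1, 0^{k₂-1}, …, 1, 0^{k_r-1})` of an index `(k₁, …, k_r)`
(with all `k_i ≥ 1`). -/
def wordOf (k : List ℕ) : List (Fin 2) :=
  k.flatMap fun j => 1 :: List.replicate (j - 1) 0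

/-- `Z_c(k₁, …, k_r)`. -/
def Z (c : ℝ) (k : List ℕ) : ℝ :=
  iteratedI c (wordOf k)

/-- The complex plane cut along `[1, ∞)`. -/
def cutPlane : Set ℂ :=
  {z | z.re < 1 ∨ z.im ≠ 0}

/-- `g` is an analytic continuation to the cut plane of the Gauss series
`∑ (a)ₙ (b)ₙ / (d)ₙ zⁿ / n!`, `|z| < 1`. -/
def IsGaussContinuation (a b d : ℂ) (g : ℂ → ℂ) : Prop :=
  DifferentiableOn ℂ g cutPlane ∧
    ∀ z ∈ Metric.ball (0 : ℂ) 1, g z = ordinaryHypergeometric a b d z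

open Classical in
/-- The Gauss hypergeometric function `₂F₁(a, b; d; z)` on the cut plane (principal branch),
i.e. the analytic continuation of the Gauss series. -/
def gaussHypergeometric (a b d z : ℂ) : ℂ :=
  if h : ∃ g, IsGaussContinuation a b d g then h.choose z else 0

theorem isOpen_cutPlane : IsOpen cutPlane :=
  (isOpen_lt Complex.continuous_re continuous_const).union
    (isOpen_ne_fun Complex.continuous_im continuous_const)

theorem ball_subset_cutPlane : Metric.ball (0 : ℂ) 1 ⊆ cutPlane := by
  intro z hz
  left
  have h := Complex.re_le_norm z
  rw [mem_ball_zero_iff] at hz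
  linarith

theorem isPreconnected_cutPlane : IsPreconnected cutPlane := by
  have h0 : StarConvex ℝ (0 : ℂ) cutPlane := by
    intro y hy s t hs ht hst
    simp only [smul_zero, zero_add]
    rcases hy with hy | hy
    · left
      rw [Complex.smul_re, smul_eq_mul]
      rcases ht.eq_or_lt with h | h
      · rw [← h]; norm_num
      · nlinarith
    · rcases ht.eq_or_lt with h | h
      · left; rw [← h]; norm_num
      · right
        rw [Complex.smul_im, smul_eq_mul]
        exact mul_ne_zero h.ne' hy
  exact (h0.isPathConnected (Or.inl (by norm_num))).isConnected.isPreconnected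

/-- The continuation is unique, so the choice in `gaussHypergeometric` is immaterial. -/
theorem gaussHypergeometric_eq {a b d : ℂ} {g : ℂ → ℂ} (hg : IsGaussContinuation a b d g)
    {z : ℂ} (hz : z ∈ cutPlane) : gaussHypergeometric a b d z = g z := by
  have h : ∃ g, IsGaussContinuation a b d g := ⟨g, hg⟩
  rw [gaussHypergeometric, dif_pos h]
  obtain ⟨h1, h2⟩ := h.choose_spec
  refine (h1.analyticOnNhd isOpen_cutPlane).eqOn_of_preconnected_of_eventuallyEq
    (hg.1.analyticOnNhd isOpen_cutPlane) isPreconnected_cutPlane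
    (z₀ := 0) (Or.inl (by norm_num)) ?_ hz
  filter_upwards [Metric.ball_mem_nhds (0 : ℂ) one_pos] with w hw
  rw [h2 w hw, hg.2 w hw]

end DeformedMZV

end

noncomputable section

namespace DeformedMZV

/-! ### Reduction of the iterated integral to a one-dimensional integral -/

/-! The word of the index (1, …, 1, m+1) with n entries is 1^n 0^m, so all variables but the last
one carrying ω₁ integrate out explicitly: the zeros give (-log t)^m/m! and the other ones give
P(t)^(n-1)/(n-1)!, with P(t) = log((1-ct)/(1-t)) the primitive of ω₁. Summing the two exponential
series under the integral sign (`hasSum_Z`) turns the double series into (1-c) Y E(c), where E(z) =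
∫₀¹ (1-t)^(-Y-1) (t^(-X) - 1) (1-zt)^(Y-1) dt.

Subtracting 1 from t^(-X) creates a zero at t = 1, so E converges for Re Y < 1, whereas the usual
Euler integral would need Re Y < 0. Expanding (1-zt)^(Y-1) and evaluating the moments by an
integration by parts shows that (1-z)⁻¹ - Y E(z) is, up to Gamma factors, the Gauss series on the
unit disc; the geometric series cancels the contribution of the subtracted 1. Since E is holomorphic
on the cut plane, this also proves that the continuation exists and covers c ≤ -1
(`isGaussContinuation_eulerIntegral`). The theorem is then 1 - (1-c) Y E(c) = (1-c) ((1-c)⁻¹ - Y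
E(c)).

Absolute convergence comes from positivity: for real X, Y in [0, 1) every term is nonnegative, and
general X, Y are dominated by |X|, |Y|. -/

/-- The simplex `a < t₁ < ⋯ < t_k < 1`. -/
def simplexAbove (a : ℝ) (k : ℕ) : Set (Fin k → ℝ) :=
  {t | (∀ i, a < t i ∧ t i < 1) ∧ StrictMono t}

theorem simplexAbove_zero (k : ℕ) : simplexAbove 0 k = openSimplex k := rfl

theorem measurableSet_simplexAbove (a : ℝ) (k : ℕ) : MeasurableSet (simplexAbove a k) := by
  have h : simplexAbove a k = (⋂ i, {t | a < t i ∧ t i < 1}) ∩ ⋂ (i) (j) (_ : i < j),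
      {t | t i < t j} := by
    ext t
    simp only [simplexAbove, StrictMono, mem_ofPred_eq, mem_inter_iff, mem_iInter]
  rw [h]
  refine (MeasurableSet.iInter fun i => ?_).inter
    (MeasurableSet.iInter fun i => .iInter fun j => .iInter fun _ => ?_)
  · exact (measurableSet_lt measurable_const (measurable_pi_apply i)).inter
      (measurableSet_lt (measurable_pi_apply i) measurable_const)
  · exact measurableSet_lt (measurable_pi_apply i) (measurable_pi_apply j)

theorem cons_mem_simplexAbove {a x : ℝ} {k : ℕ} {t : Fin k → ℝ} :
    (Fin.cons x t : Fin (k + 1) → ℝ) ∈ simplexAbove a (k + 1) ↔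
      x ∈ Ioo a 1 ∧ t ∈ simplexAbove x k := by
  constructor
  · rintro ⟨h1, h2⟩
    refine ⟨by simpa using h1 0, fun i => ⟨?_, ?_⟩, fun i j hij => ?_⟩
    · simpa using h2 (Fin.succ_pos i)
    · simpa using (h1 i.succ).2
    · simpa using h2 (Fin.succ_lt_succ_iff.2 hij)
  · rintro ⟨h1, h2, h3⟩
    refine ⟨fun i => ?_, fun i j => ?_⟩
    · induction i using Fin.cases with
      | zero => simpa using h1
      | succ i => simpa using ⟨h1.1.trans (h2 i).1, (h2 i).2⟩
    · induction i using Fin.cases <;> induction j using Fin.cases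
      · simp
      · intro _; simpa using (h2 _).1
      · simp
      · intro hij; simpa using h3 (Fin.succ_lt_succ_iff.1 hij)

theorem measurable_omega (c : ℝ) (e : Fin 2) : Measurable (omega c e) := by
  unfold omega
  split_ifs <;> fun_prop

theorem measurable_integrand (c : ℝ) (w : List (Fin 2)) : Measurable (integrand c w) :=
  Finset.measurable_fun_prod _ fun i _ => (measurable_omega c _).comp (measurable_pi_apply i)

theorem one_sub_mul_pos {c t : ℝ} (hc : c < 1) (h0 : 0 ≤ t) (h1 : t < 1) : 0 < 1 - c * t := by
  nlinarith

theorem omega_nonneg {c : ℝ} (hc : c < 1) (e : Fin 2) {t : ℝ} (h0 : 0 ≤ t) (h1 : t < 1) :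
    0 ≤ omega c e t := by
  have := one_sub_mul_pos hc h0 h1
  have : 0 < 1 - t := by linarith
  have : 0 < 1 - c := by linarith
  unfold omega
  split_ifs <;> positivity

theorem integrand_nonneg {c : ℝ} (hc : c < 1) (w : List (Fin 2)) {t : Fin w.length → ℝ}
    (ht : t ∈ openSimplex w.length) : 0 ≤ integrand c w t :=
  Finset.prod_nonneg fun i _ => omega_nonneg hc _ (ht.1 i).1.le (ht.1 i).2

/-- The iterated integral over `a < t₁ < ⋯ < t_k < 1` as a Lebesgue integral. -/
def iteratedL (c : ℝ) (w : List (Fin 2)) (a : ℝ) : ENNReal :=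
  ∫⁻ t in simplexAbove a w.length, ENNReal.ofReal (integrand c w t)

theorem iteratedL_nil (c a : ℝ) : iteratedL c [] a = 1 := by
  have h : simplexAbove a ([] : List (Fin 2)).length = univ := by
    ext t
    simp only [mem_univ, iff_true]
    exact ⟨fun i => i.elim0, fun i => i.elim0⟩
  have : IsEmpty (Fin ([] : List (Fin 2)).length) := inferInstanceAs (IsEmpty (Fin 0))
  rw [iteratedL, h, Measure.restrict_univ, volume_pi,
    Measure.pi_of_empty (α := Fin ([] : List (Fin 2)).length), lintegral_dirac]
  simp [integrand]

/-- Tonelli, splitting off the smallest variable. Working with nonnegative Lebesgue integrals lets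
the whole recursion run before any integrability is known. -/
theorem iteratedL_cons {c : ℝ} (hc : c < 1) (e : Fin 2) (w : List (Fin 2)) {a : ℝ} (ha : 0 ≤ a) :
    iteratedL c (e :: w) a =
      ∫⁻ x in Ioo a 1, ENNReal.ofReal (omega c e x) * iteratedL c w x := by
  have hm := measurableSet_simplexAbove a (w.length + 1)
  have hf : Measurable ((simplexAbove a (w.length + 1)).indicator
      fun t => ENNReal.ofReal (integrand c (e :: w) t)) :=
    (measurable_integrand c (e :: w)).ennreal_ofReal.indicator hm
  have hp := (volume_preserving_piFinSuccAbove (fun _ : Fin (w.length + 1) => ℝ) 0).symm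
  have h1 : iteratedL c (e :: w) a = ∫⁻ t, (simplexAbove a (w.length + 1)).indicator
      (fun t => ENNReal.ofReal (integrand c (e :: w) t)) t :=
    (lintegral_indicator hm _).symm
  rw [h1, ← hp.lintegral_comp hf, Measure.volume_eq_prod,
    lintegral_prod (fun p => (simplexAbove a (w.length + 1)).indicator
      (fun t => ENNReal.ofReal (integrand c (e :: w) t))
      ((MeasurableEquiv.piFinSuccAbove (fun _ : Fin (w.length + 1) => ℝ) 0).symm p))
      (hf.comp hp.measurable).aemeasurable, ← lintegral_indicator measurableSet_Ioo]
  refine lintegral_congr fun x => ?_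
  have h2 (t : Fin w.length → ℝ) :
      (MeasurableEquiv.piFinSuccAbove (fun _ : Fin (w.length + 1) => ℝ) 0).symm (x, t) =
        Fin.cons x t := by
    rw [MeasurableEquiv.piFinSuccAbove_symm_apply]
    exact Fin.insertNth_zero' x t
  simp_rw [h2]
  by_cases hx : x ∈ Ioo a 1
  · rw [indicator_of_mem hx, iteratedL,
      ← lintegral_const_mul _ (measurable_integrand c w).ennreal_ofReal,
      ← lintegral_indicator (measurableSet_simplexAbove x _)]
    refine lintegral_congr fun t => ?_
    by_cases ht : t ∈ simplexAbove x w.length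
    · rw [indicator_of_mem ht, indicator_of_mem (cons_mem_simplexAbove.2 ⟨hx, ht⟩),
        ← ENNReal.ofReal_mul (omega_nonneg hc e (ha.trans hx.1.le) hx.2)]
      congr 1
      simp only [integrand]
      exact Fin.prod_univ_succ _
    · rw [indicator_of_notMem ht, indicator_of_notMem]
      exact fun h => ht (cons_mem_simplexAbove.1 h).2
  · rw [indicator_of_notMem hx, lintegral_eq_zero_of_ae_eq_zero]
    refine .of_forall fun t => ?_
    exact indicator_of_notMem (fun h => hx (cons_mem_simplexAbove.1 h).1) _

/-- A nonnegative derivative of a continuous function is automatically integrable, so the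
fundamental theorem of calculus applies without an integrability hypothesis. -/
theorem lintegral_ofReal_deriv {f F : ℝ → ℝ} {a b : ℝ} (hab : a ≤ b)
    (hF : ContinuousOn F (Icc a b)) (hd : ∀ x ∈ Ioo a b, HasDerivAt F (f x) x)
    (hf : ∀ x ∈ Ioo a b, 0 ≤ f x) :
    ∫⁻ x in Ioo a b, ENNReal.ofReal (f x) = ENNReal.ofReal (F b - F a) := by
  have hi : IntegrableOn f (Ioc a b) :=
    intervalIntegral.integrableOn_deriv_of_nonneg hF hd hf
  rw [← intervalIntegral.integral_eq_sub_of_hasDerivAt_of_le hab hF hd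
    ((intervalIntegrable_iff_integrableOn_Ioc_of_le hab).2 hi),
    intervalIntegral.integral_of_le hab, integral_Ioc_eq_integral_Ioo,
    ofReal_integral_eq_lintegral_ofReal (hi.mono_set Ioo_subset_Ioc_self)]
  exact (ae_restrict_iff' measurableSet_Ioo).2 (.of_forall hf)

theorem iteratedL_replicate_zero {c : ℝ} (hc : c < 1) (m : ℕ) {a : ℝ} (h0 : 0 < a) (h1 : a < 1) :
    iteratedL c (List.replicate m 0) a =
      ENNReal.ofReal ((-Real.log a) ^ m / m.factorial) := by
  induction m generalizing a with
  | zero => simp [iteratedL_nil]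
  | succ m ih =>
    rw [List.replicate_succ, iteratedL_cons hc _ _ h0.le]
    have h (x : ℝ) (hx : x ∈ Ioo a 1) : ENNReal.ofReal (omega c 0 x) *
        iteratedL c (List.replicate m 0) x =
          ENNReal.ofReal (x⁻¹ * ((-Real.log x) ^ m / m.factorial)) := by
      rw [ih (h0.trans hx.1) hx.2, ENNReal.ofReal_mul (inv_nonneg.2 (h0.trans hx.1).le)]
      simp [omega]
    rw [setLIntegral_congr_fun measurableSet_Ioo h]
    have hF : ∀ x ∈ Icc a 1, HasDerivAt
        (fun x => -((-Real.log x) ^ (m + 1) / ((m + 1).factorial : ℝ)))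
        (x⁻¹ * ((-Real.log x) ^ m / m.factorial)) x := by
      intro x hx
      have hx0 : x ≠ 0 := (h0.trans_le hx.1).ne'
      convert! (((Real.hasDerivAt_log hx0).neg.pow (m + 1)).div_const _).neg using 1
      have : (m.factorial : ℝ) ≠ 0 := by positivity
      rw [Nat.factorial_succ]
      push_cast
      field_simp
      simp
    rw [lintegral_ofReal_deriv h1.le
      (fun x hx => (hF x hx).continuousAt.continuousWithinAt)
      (fun x hx => hF x (Ioo_subset_Icc_self hx))]
    · simp
    · intro x hx
      have := Real.log_nonpos (h0.trans hx.1).le hx.2.le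
      have := h0.trans hx.1
      have : 0 ≤ -Real.log x := by linarith
      positivity

/-- The primitive of `ω₁` vanishing at `0`. -/
def primitive (c t : ℝ) : ℝ :=
  Real.log (1 - c * t) - Real.log (1 - t)

theorem primitive_zero (c : ℝ) : primitive c 0 = 0 := by simp [primitive]

theorem hasDerivAt_primitive {c t : ℝ} (hc : c < 1) (h0 : 0 ≤ t) (h1 : t < 1) :
    HasDerivAt (primitive c) (omega c 1 t) t := by
  have h2 := one_sub_mul_pos hc h0 h1
  have h3 : 0 < 1 - t := by linarith
  convert! ((((hasDerivAt_id t).const_mul c).const_sub 1).log h2.ne').sub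
    (((hasDerivAt_id t).const_sub 1).log h3.ne') using 1
  have h4 := h2.ne'
  have h5 := h3.ne'
  simp only [omega, id, one_ne_zero, if_false]
  field_simp
  ring

theorem primitive_mono {c s t : ℝ} (hc : c < 1) (h0 : 0 ≤ s) (hst : s ≤ t) (h1 : t < 1) :
    primitive c s ≤ primitive c t := by
  have hm : MonotoneOn (primitive c) (Ico 0 1) :=
    monotoneOn_of_hasDerivWithinAt_nonneg (convex_Ico 0 1)
      (fun x hx => (hasDerivAt_primitive hc hx.1 hx.2).continuousAt.continuousWithinAt)
      (fun x hx => (hasDerivAt_primitive hc (interior_subset hx).1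
        (interior_subset hx).2).hasDerivWithinAt)
      (fun x hx => omega_nonneg hc 1 (interior_subset hx).1 (interior_subset hx).2)
  exact hm ⟨h0, hst.trans_lt h1⟩ ⟨h0.trans hst, h1⟩ hst

theorem measurable_primitive (c : ℝ) : Measurable (primitive c) := by
  unfold primitive
  fun_prop

theorem lintegral_omega_mul_pow {c : ℝ} (hc : c < 1) (n : ℕ) {a t : ℝ} (h0 : 0 ≤ a)
    (hat : a ≤ t) (h1 : t < 1) :
    ∫⁻ s in Ioo a t, ENNReal.ofReal
        (omega c 1 s * ((primitive c t - primitive c s) ^ n / n.factorial)) =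
      ENNReal.ofReal ((primitive c t - primitive c a) ^ (n + 1) / (n + 1).factorial) := by
  have hF : ∀ x ∈ Icc a t, HasDerivAt
      (fun s => -((primitive c t - primitive c s) ^ (n + 1) / ((n + 1).factorial : ℝ)))
      (omega c 1 x * ((primitive c t - primitive c x) ^ n / n.factorial)) x := by
    intro x hx
    convert! ((((hasDerivAt_primitive hc (h0.trans hx.1) (hx.2.trans_lt h1)).const_sub
      (primitive c t)).pow (n + 1)).div_const _).neg using 1
    have : (n.factorial : ℝ) ≠ 0 := by positivity
    rw [Nat.factorial_succ]
    push_cast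
    field_simp
  rw [lintegral_ofReal_deriv hat
    (fun x hx => (hF x hx).continuousAt.continuousWithinAt)
    (fun x hx => hF x (Ioo_subset_Icc_self hx))]
  · simp
  · intro x hx
    have h2 := omega_nonneg hc 1 (h0.trans hx.1.le) (hx.2.trans h1)
    have h3 := sub_nonneg.2 (primitive_mono hc (h0.trans hx.1.le) hx.2.le h1)
    positivity

/-- The variable t kept on the right is the largest one carrying ω₁. Each further ω₁ is absorbed by
exchanging it with t and integrating over a < s < t, which raises the power of P(t) - P(a) by one.
-/
theorem iteratedL_replicate {c : ℝ} (hc : c < 1) (m n : ℕ) {a : ℝ} (h0 : 0 ≤ a) :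
    iteratedL c (List.replicate (n + 1) 1 ++ List.replicate m 0) a =
      ∫⁻ t in Ioo a 1, ENNReal.ofReal (omega c 1 t * ((-Real.log t) ^ m / m.factorial)) *
        ENNReal.ofReal ((primitive c t - primitive c a) ^ n / n.factorial) := by
  have hg : Measurable fun t => ENNReal.ofReal
      (omega c 1 t * ((-Real.log t) ^ m / m.factorial)) :=
    ((measurable_omega c 1).mul
      ((Real.measurable_log.neg.pow_const m).div_const _)).ennreal_ofReal
  induction n generalizing a with
  | zero =>
    rw [List.replicate_one, List.singleton_append, iteratedL_cons hc _ _ h0]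
    refine setLIntegral_congr_fun measurableSet_Ioo fun t ht => ?_
    have ht0 := h0.trans_lt ht.1
    rw [iteratedL_replicate_zero hc m ht0 ht.2, ENNReal.ofReal_mul (omega_nonneg hc 1 ht0.le ht.2)]
    simp
  | succ n ih =>
    rw [List.replicate_succ, List.cons_append, iteratedL_cons hc _ _ h0]
    set g := fun t => ENNReal.ofReal (omega c 1 t * ((-Real.log t) ^ m / m.factorial)) with hgdef
    -- The constraint s < t is encoded by an indicator on the square, so that Tonelli applies to a
    -- product domain.
    have hK : Measurable fun p : ℝ × ℝ => {p : ℝ × ℝ | p.1 < p.2}.indicator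
        (fun p => ENNReal.ofReal (omega c 1 p.1) * (g p.2 *
          ENNReal.ofReal ((primitive c p.2 - primitive c p.1) ^ n / n.factorial))) p := by
      refine Measurable.indicator ?_ (measurableSet_lt measurable_fst measurable_snd)
      have h1 := measurable_primitive c
      have h2 := measurable_omega c 1
      fun_prop
    have hL (s : ℝ) (hs : s ∈ Ioo a 1) : ENNReal.ofReal (omega c 1 s) *
        iteratedL c (List.replicate (n + 1) 1 ++ List.replicate m 0) s =
        ∫⁻ t in Ioo a 1, {p : ℝ × ℝ | p.1 < p.2}.indicator
        (fun p => ENNReal.ofReal (omega c 1 p.1) * (g p.2 *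
          ENNReal.ofReal ((primitive c p.2 - primitive c p.1) ^ n / n.factorial))) (s, t) := by
      have hm := measurable_primitive c
      have hm' := measurable_omega c 1
      rw [ih (h0.trans hs.1.le), ← lintegral_const_mul _ (by fun_prop),
        ← lintegral_indicator measurableSet_Ioo, ← lintegral_indicator measurableSet_Ioo]
      refine lintegral_congr fun t => ?_
      by_cases ht : t ∈ Ioo s 1
      · have ht' : t ∈ Ioo a 1 := ⟨hs.1.trans ht.1, ht.2⟩
        rw [indicator_of_mem ht, indicator_of_mem ht', indicator_of_mem]
        exact ht.1
      · rw [indicator_of_notMem ht]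
        by_cases ht' : t ∈ Ioo a 1
        · rw [indicator_of_mem ht', indicator_of_notMem]
          exact fun h => ht ⟨h, ht'.2⟩
        · rw [indicator_of_notMem ht']
    rw [setLIntegral_congr_fun measurableSet_Ioo hL, lintegral_lintegral_swap hK.aemeasurable]
    refine setLIntegral_congr_fun measurableSet_Ioo fun t ht => ?_
    have h1 := measurable_primitive c
    have h2 := measurable_omega c 1
    rw [← lintegral_omega_mul_pow hc n h0 ht.1.le ht.2, ← lintegral_const_mul _ (by fun_prop),
      ← lintegral_indicator measurableSet_Ioo, ← lintegral_indicator measurableSet_Ioo]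
    refine lintegral_congr fun s => ?_
    by_cases hs : s ∈ Ioo a t
    · have hs' : s ∈ Ioo a 1 := ⟨hs.1, hs.2.trans ht.2⟩
      rw [indicator_of_mem hs, indicator_of_mem hs', indicator_of_mem (by exact hs.2),
        ENNReal.ofReal_mul (omega_nonneg hc 1 (h0.trans hs.1.le) hs'.2)]
      ring
    · rw [indicator_of_notMem hs]
      by_cases hs' : s ∈ Ioo a 1
      · rw [indicator_of_mem hs', indicator_of_notMem]
        exact fun h => hs ⟨hs'.1, h⟩
      · rw [indicator_of_notMem hs']

theorem wordOf_replicate (m n : ℕ) :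
    wordOf (List.replicate n 1 ++ [m + 1]) =
      List.replicate (n + 1) 1 ++ List.replicate m 0 := by
  induction n with
  | zero => simp [wordOf]
  | succ n ih =>
    rw [List.replicate_succ, List.cons_append, wordOf, List.flatMap_cons, ← wordOf, ih]
    simp [List.replicate_succ]

/-- The integrand of the one-dimensional integral for `Z_c(1, …, 1, m + 1)` with `n` ones. -/
def kernel (c : ℝ) (m n : ℕ) (t : ℝ) : ℝ :=
  omega c 1 t * ((-Real.log t) ^ m / m.factorial) * (primitive c t ^ n / n.factorial)

theorem measurable_kernel (c : ℝ) (m n : ℕ) : Measurable (kernel c m n) := by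
  have h1 := measurable_primitive c
  have h2 := measurable_omega c 1
  unfold kernel
  fun_prop

theorem kernel_nonneg {c : ℝ} (hc : c < 1) (m n : ℕ) {t : ℝ} (ht : t ∈ Ioo (0 : ℝ) 1) :
    0 ≤ kernel c m n t := by
  have h1 := omega_nonneg hc 1 ht.1.le ht.2
  have h2 : 0 ≤ -Real.log t := by linarith [Real.log_nonpos ht.1.le ht.2.le]
  have h3 : 0 ≤ primitive c t := primitive_zero c ▸ primitive_mono hc le_rfl ht.1.le ht.2
  unfold kernel
  positivity

theorem iteratedL_eq_lintegral_kernel {c : ℝ} (hc : c < 1) (m n : ℕ) :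
    iteratedL c (wordOf (List.replicate n 1 ++ [m + 1])) 0 =
      ∫⁻ t in Ioo (0 : ℝ) 1, ENNReal.ofReal (kernel c m n t) := by
  rw [wordOf_replicate, iteratedL_replicate hc m n le_rfl]
  refine setLIntegral_congr_fun measurableSet_Ioo fun t ht => ?_
  have h1 := omega_nonneg hc 1 ht.1.le ht.2
  have h2 : 0 ≤ -Real.log t := by linarith [Real.log_nonpos ht.1.le ht.2.le]
  simp only [primitive_zero, sub_zero, kernel]
  rw [ENNReal.ofReal_mul (by positivity : 0 ≤ omega c 1 t * ((-Real.log t) ^ m / m.factorial))]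

/-- The integrand is nonnegative on the simplex, so finiteness of the iterated Lebesgue integral is
already absolute convergence. -/
theorem integrableOn_integrand {c : ℝ} (hc : c < 1) {m n : ℕ}
    (h : IntegrableOn (kernel c m n) (Ioo 0 1)) :
    IntegrableOn (integrand c (wordOf (List.replicate n 1 ++ [m + 1])))
      (openSimplex (wordOf (List.replicate n 1 ++ [m + 1])).length) := by
  refine ⟨(measurable_integrand c _).aestronglyMeasurable, ?_⟩
  rw [hasFiniteIntegral_iff_ofReal, ← simplexAbove_zero]
  · change iteratedL c _ 0 < ⊤
    rw [iteratedL_eq_lintegral_kernel hc]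
    refine (hasFiniteIntegral_iff_ofReal ?_).1 h.2
    exact (ae_restrict_iff' measurableSet_Ioo).2 (.of_forall fun t ht => kernel_nonneg hc m n ht)
  · exact (ae_restrict_iff' (measurableSet_simplexAbove 0 _)).2
      (.of_forall fun t ht => integrand_nonneg hc _ ht)

theorem Z_eq_integral_kernel {c : ℝ} (hc : c < 1) (m n : ℕ) :
    Z c (List.replicate n 1 ++ [m + 1]) = ∫ t in Ioo (0 : ℝ) 1, kernel c m n t := by
  rw [Z, iteratedI, integral_eq_lintegral_of_nonneg_ae, integral_eq_lintegral_of_nonneg_ae,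
    ← iteratedL_eq_lintegral_kernel hc, iteratedL, simplexAbove_zero]
  · exact (ae_restrict_iff' measurableSet_Ioo).2 (.of_forall fun t ht => kernel_nonneg hc m n ht)
  · exact (measurable_kernel c m n).aestronglyMeasurable
  · exact (ae_restrict_iff' (measurableSet_simplexAbove 0 _)).2
      (.of_forall fun t ht => integrand_nonneg hc _ ht)
  · exact (measurable_integrand c _).aestronglyMeasurable

/-! ### A regularised Euler integral -/

-- Integrate the derivative of (1-t)^s (t^a - t^b) over (0, 1), using t^a = t^(a-1) - (1-t) t^(a-1),
-- and likewise for b, to reach beta integrands. The boundary terms vanish even when Re s is in (-1,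
-- 0], because t^a - t^b has a zero at t = 1.
open Filter Topology in
theorem mul_integral_one_sub_cpow_mul_sub {a b s : ℂ} (ha : 0 < a.re) (hb : 0 < b.re)
    (hs : -1 < s.re)
    (hi : IntegrableOn (fun t : ℝ => (1 - t : ℂ) ^ (s - 1) * ((t : ℂ) ^ (a - 1) - (t : ℂ) ^ (b - 1)))
      (Ioo 0 1)) :
    s * ∫ t in Ioo (0 : ℝ) 1, (1 - t : ℂ) ^ (s - 1) * ((t : ℂ) ^ (a - 1) - (t : ℂ) ^ (b - 1)) =
      (a + s) * Complex.betaIntegral a (s + 1) - (b + s) * Complex.betaIntegral b (s + 1) := by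
  have hs' : 0 < (s + 1).re := by simpa using by linarith
  have hA := Complex.betaIntegral_convergent ha hs'
  have hB := Complex.betaIntegral_convergent hb hs'
  have hJ : IntervalIntegrable (fun t : ℝ => (1 - t : ℂ) ^ (s - 1) *
      ((t : ℂ) ^ (a - 1) - (t : ℂ) ^ (b - 1))) volume 0 1 :=
    (intervalIntegrable_iff_integrableOn_Ioo_of_le zero_le_one).2 hi
  have hint := ((hA.const_mul (a + s)).sub (hB.const_mul (b + s))).sub (hJ.const_mul s)
  have hd (u : ℂ) (x : ℝ) (hx : 0 < x) :
      HasDerivAt (fun t : ℝ => (t : ℂ) ^ u) (u * (x : ℂ) ^ (u - 1)) x := by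
    have h := (hasDerivAt_id (x : ℂ)).cpow_const (c := u) (Complex.ofReal_mem_slitPlane.2 hx)
    simpa using h.comp_ofReal
  have hd' (u : ℂ) (x : ℝ) (hx : x < 1) :
      HasDerivAt (fun t : ℝ => (1 - t : ℂ) ^ u) (-(u * (1 - x : ℂ) ^ (u - 1))) x := by
    have h := ((hasDerivAt_id (x : ℂ)).const_sub 1).cpow_const (c := u)
      (by simpa using Complex.ofReal_mem_slitPlane.2 (sub_pos.2 hx))
    simpa using h.comp_ofReal
  have key := intervalIntegral.integral_eq_sub_of_hasDerivAt_of_tendsto zero_lt_one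
    (f := fun t : ℝ => (1 - t : ℂ) ^ s * ((t : ℂ) ^ a - (t : ℂ) ^ b)) (fa := 0) (fb := 0)
    ?_ hint ?_ ?_
  · rw [intervalIntegral.integral_sub ((hA.const_mul _).sub (hB.const_mul _)) (hJ.const_mul _),
      intervalIntegral.integral_sub (hA.const_mul _) (hB.const_mul _),
      intervalIntegral.integral_const_mul, intervalIntegral.integral_const_mul,
      intervalIntegral.integral_const_mul,
      intervalIntegral.integral_of_le (f := fun t : ℝ => (1 - t : ℂ) ^ (s - 1) *
      ((t : ℂ) ^ (a - 1) - (t : ℂ) ^ (b - 1))) zero_le_one, integral_Ioc_eq_integral_Ioo] at key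
    simp only [Complex.betaIntegral]
    linear_combination -key
  · intro x hx
    have hx0 : (x : ℂ) ≠ 0 := Complex.ofReal_ne_zero.2 hx.1.ne'
    have hx1 : (1 - x : ℂ) ≠ 0 := by
      rw [← Complex.ofReal_one, ← Complex.ofReal_sub]
      exact Complex.ofReal_ne_zero.2 (sub_pos.2 hx.2).ne'
    convert! (hd' s x hx.2).mul ((hd a x hx.1).sub (hd b x hx.1)) using 1
    simp only [Pi.sub_apply, add_sub_cancel_right, Complex.cpow_sub _ _ hx0, Complex.cpow_sub _ _ hx1,
      Complex.cpow_one]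
    field_simp
    ring
  · have h0 (u : ℂ) (hu : 0 < u.re) : ContinuousAt (fun t : ℝ => (t : ℂ) ^ u) 0 :=
      Complex.continuousAt_ofReal_cpow_const 0 u (Or.inl hu)
    have h : Tendsto (fun t : ℝ => (1 - t : ℂ) ^ s * ((t : ℂ) ^ a - (t : ℂ) ^ b)) (𝓝 0) _ :=
      ((hd' s 0 one_pos).continuousAt.tendsto.mul ((h0 a ha).tendsto.sub (h0 b hb).tendsto))
    have ha0 : a ≠ 0 := by rintro rfl; simp at ha
    have hb0 : b ≠ 0 := by rintro rfl; simp at hb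
    simp only [Complex.ofReal_zero, Complex.zero_cpow ha0, Complex.zero_cpow hb0, sub_zero,
      mul_zero] at h
    exact h.mono_left nhdsWithin_le_nhds
  -- Near t = 1 the function is -(1-t)^(s+1) times the slope of t^a - t^b at 1: the slope converges
  -- and the power tends to 0 since Re (s+1) > 0.
  · have hdiff := ((hd a 1 one_pos).sub (hd b 1 one_pos)).hasDerivWithinAt (s := Iio 1)
    rw [hasDerivWithinAt_iff_tendsto_slope' (by simp)] at hdiff
    have hc : ContinuousAt (fun t : ℝ => (1 - t : ℂ) ^ (s + 1)) 1 := by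
      have h1 : ContinuousAt (fun t : ℝ => (t : ℂ) ^ (s + 1)) (1 - 1) := by
        rw [sub_self]
        exact Complex.continuousAt_ofReal_cpow_const 0 _ (Or.inl hs')
      have h2 := ContinuousAt.comp (f := fun t : ℝ => 1 - t) h1 (by fun_prop)
      simpa [Function.comp_def] using h2
    have hs0 : s + 1 ≠ 0 := by intro h; simp [h] at hs'
    have hc' := hc.tendsto.mono_left (nhdsWithin_le_nhds (s := Iio 1))
    simp only [Complex.ofReal_one, sub_self, Complex.zero_cpow hs0] at hc'
    have h := (hc'.mul hdiff).neg
    rw [zero_mul, neg_zero] at h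
    refine h.congr' ?_
    filter_upwards [self_mem_nhdsWithin] with t ht
    have ht1 : (1 - t : ℂ) ≠ 0 := by
      rw [← Complex.ofReal_one, ← Complex.ofReal_sub]
      exact Complex.ofReal_ne_zero.2 (sub_pos.2 ht).ne'
    have ht2 : (t - 1 : ℂ) ≠ 0 := by rw [← neg_sub]; exact neg_ne_zero.2 ht1
    simp only [slope_def_module, Complex.cpow_add _ _ ht1, Complex.cpow_one, Complex.real_smul,
      Pi.sub_apply, Complex.ofReal_one, Complex.one_cpow, Complex.ofReal_inv, Complex.ofReal_sub]
    field_simp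
    ring

/-- The kernel `(1 - t) ^ (-Y - 1) (t ^ (-X) - 1)` of the regularised Euler integral. -/
def eulerKernel (X Y : ℂ) (t : ℝ) : ℂ :=
  (1 - t : ℂ) ^ (-Y - 1) * ((t : ℂ) ^ (-X) - 1)

/-- From |e^w - 1| ≤ e^|w| - 1 with w = -X log t the left side is at most t^(-|X|) - 1, and t ≤
t^|X| extracts the factor 1-t. This factor compensates the exponent -Y-1 in `eulerKernel`. -/
theorem norm_cpow_neg_sub_one_le {X : ℂ} (hX : ‖X‖ < 1) {t : ℝ} (ht : t ∈ Ioo (0 : ℝ) 1) :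
    ‖(t : ℂ) ^ (-X) - 1‖ ≤ t ^ (-‖X‖) * (1 - t) := by
  have hl : 0 ≤ -Real.log t := by linarith [Real.log_nonpos ht.1.le ht.2.le]
  have h1 := Complex.norm_exp_sub_sum_le_exp_norm_sub_sum (Complex.log t * -X) 1
  simp only [Finset.sum_range_one, pow_zero, Nat.factorial_zero, Nat.cast_one, div_one] at h1
  rw [← Complex.cpow_def_of_ne_zero (Complex.ofReal_ne_zero.2 ht.1.ne'), norm_mul, norm_neg,
    ← Complex.ofReal_log ht.1.le, Complex.norm_real, Real.norm_eq_abs,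
    ← abs_neg, abs_of_nonneg hl, neg_mul_comm, ← Real.rpow_def_of_pos ht.1] at h1
  refine h1.trans ?_
  have h2 : t ≤ t ^ ‖X‖ := by
    simpa using Real.rpow_le_rpow_of_exponent_ge ht.1 ht.2.le hX.le
  have h3 := Real.rpow_pos_of_pos ht.1 (-‖X‖)
  have h4 : t ^ (-‖X‖) * t ^ ‖X‖ = 1 := by
    rw [← Real.rpow_add ht.1]; simp
  nlinarith

theorem measurable_eulerKernel (X Y : ℂ) : Measurable (eulerKernel X Y) := by
  unfold eulerKernel
  fun_prop

theorem integrableOn_eulerKernel {X Y : ℂ} (hX : ‖X‖ < 1) (hY : Y.re < 1) :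
    IntegrableOn (eulerKernel X Y) (Ioo 0 1) := by
  -- The dominating function is the beta integrand with parameters 1-|X| and 1-Y.
  have hu : 0 < (1 - ‖X‖ : ℂ).re := by simpa using hX
  have hv : 0 < (1 - Y).re := by simpa using hY
  have hb := (intervalIntegrable_iff_integrableOn_Ioo_of_le zero_le_one).1
    (Complex.betaIntegral_convergent hu hv)
  refine Integrable.mono hb (measurable_eulerKernel X Y).aestronglyMeasurable ?_
  refine (ae_restrict_iff' measurableSet_Ioo).2 (.of_forall fun t ht => ?_)
  have h1 : 0 < 1 - t := sub_pos.2 ht.2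
  have h2 (u : ℂ) : ‖(1 - t : ℂ) ^ u‖ = (1 - t) ^ u.re := by
    rw [← Complex.ofReal_one, ← Complex.ofReal_sub, Complex.norm_cpow_eq_rpow_re_of_pos h1]
  rw [eulerKernel, norm_mul, norm_mul, h2, h2, Complex.norm_cpow_eq_rpow_re_of_pos ht.1]
  refine (mul_le_mul_of_nonneg_left (norm_cpow_neg_sub_one_le hX ht)
    (Real.rpow_nonneg h1.le _)).trans (le_of_eq ?_)
  have h3 : (1 - t) ^ (1 - Y - 1 : ℂ).re = (1 - t) ^ (-Y - 1 : ℂ).re * (1 - t) := by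
    rw [← Real.rpow_add_one h1.ne']
    congr 1
    simp
  rw [h3]
  simp
  ring

/-! ### Holomorphy of the Euler integral on the cut plane -/

theorem one_sub_mul_mem_slitPlane {z : ℂ} (hz : z ∈ cutPlane) {t : ℝ} (ht : t ∈ Icc (0 : ℝ) 1) :
    1 - z * t ∈ Complex.slitPlane := by
  rw [Complex.mem_slitPlane_iff]
  rcases ht.1.eq_or_lt with h | h
  · left; simp [← h]
  rcases hz with hz | hz
  · left
    simp only [Complex.sub_re, Complex.one_re, Complex.re_mul_ofReal]
    nlinarith [ht.2]
  · right
    simpa using ⟨hz, h.ne'⟩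

/-- The regularised Euler integral `∫₀¹ (1 - t) ^ (-Y - 1) (t ^ (-X) - 1) (1 - z t) ^ (Y - 1) dt`. -/
def eulerIntegral (X Y z : ℂ) : ℂ :=
  ∫ t in Ioo (0 : ℝ) 1, eulerKernel X Y t * (1 - z * t) ^ (Y - 1)

theorem continuousOn_one_sub_mul_cpow (u : ℂ) :
    ContinuousOn (fun p : ℂ × ℝ => (1 - p.1 * p.2) ^ u) (cutPlane ×ˢ Icc 0 1) :=
  ContinuousOn.cpow (by fun_prop) continuousOn_const
    fun _ hp => one_sub_mul_mem_slitPlane hp.1 hp.2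

theorem integrableOn_eulerKernel_mul {X Y : ℂ} (hX : ‖X‖ < 1) (hY : Y.re < 1) (u : ℂ) {z : ℂ}
    (hz : z ∈ cutPlane) :
    IntegrableOn (fun t : ℝ => eulerKernel X Y t * (1 - z * t) ^ u) (Ioo 0 1) := by
  have hc : ContinuousOn (fun t : ℝ => (1 - z * t) ^ u) (Icc 0 1) :=
    (continuousOn_one_sub_mul_cpow u).comp (f := fun t : ℝ => (z, t)) (by fun_prop)
      fun t ht => ⟨hz, ht⟩
  obtain ⟨C, hC⟩ := isCompact_Icc.exists_bound_of_continuousOn hc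
  refine (integrableOn_eulerKernel hX hY).mul_bdd (c := C) ?_ ?_
  · exact (by fun_prop : Measurable fun t : ℝ => (1 - z * t) ^ u).aestronglyMeasurable
  · exact (ae_restrict_iff' measurableSet_Ioo).2
      (.of_forall fun t ht => hC t (Ioo_subset_Icc_self ht))

theorem differentiableOn_eulerIntegral {X Y : ℂ} (hX : ‖X‖ < 1) (hY : Y.re < 1) :
    DifferentiableOn ℂ (eulerIntegral X Y) cutPlane := by
  intro z₀ hz₀
  -- Compactness of a closed disc times [0, 1] bounds the z-derivative of (1-zt)^(Y-1) uniformly, so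
  -- `eulerKernel` times a constant dominates.
  obtain ⟨r, hr, hball⟩ := Metric.nhds_basis_closedBall.mem_iff.1 (isOpen_cutPlane.mem_nhds hz₀)
  have hK : IsCompact (Metric.closedBall z₀ r ×ˢ Icc (0 : ℝ) 1) :=
    (isCompact_closedBall z₀ r).prod isCompact_Icc
  have hcont : ContinuousOn
      (fun p : ℂ × ℝ => (Y - 1) * (1 - p.1 * p.2) ^ (Y - 1 - 1) * (-(p.2 : ℂ)))
      (Metric.closedBall z₀ r ×ˢ Icc (0 : ℝ) 1) :=
    (continuousOn_const.mul ((continuousOn_one_sub_mul_cpow _).mono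
      (prod_mono hball subset_rfl))).mul (by fun_prop)
  obtain ⟨C, hC⟩ := hK.exists_bound_of_continuousOn hcont
  refine DifferentiableAt.differentiableWithinAt ?_
  have h := hasDerivAt_integral_of_dominated_loc_of_deriv_le
    (μ := volume.restrict (Ioo (0 : ℝ) 1)) (𝕜 := ℂ)
    (F := fun z t => eulerKernel X Y t * (1 - z * t) ^ (Y - 1))
    (F' := fun z t => eulerKernel X Y t * ((Y - 1) * (1 - z * t) ^ (Y - 1 - 1) * (-(t : ℂ))))
    (x₀ := z₀) (s := Metric.closedBall z₀ r) (bound := fun t => ‖eulerKernel X Y t‖ * C)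
    (Metric.closedBall_mem_nhds z₀ hr) ?_ ?_ ?_ ?_ ?_ ?_
  · exact h.2.differentiableAt
  · have := measurable_eulerKernel X Y
    exact .of_forall fun z => (by fun_prop : Measurable fun t : ℝ =>
      eulerKernel X Y t * (1 - z * t) ^ (Y - 1)).aestronglyMeasurable
  · exact integrableOn_eulerKernel_mul hX hY _ hz₀
  · have := measurable_eulerKernel X Y
    exact (by fun_prop : Measurable fun t : ℝ => eulerKernel X Y t *
      ((Y - 1) * (1 - z₀ * t) ^ (Y - 1 - 1) * (-(t : ℂ)))).aestronglyMeasurable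
  · refine (ae_restrict_iff' measurableSet_Ioo).2 (.of_forall fun t ht z hz => ?_)
    rw [norm_mul]
    exact mul_le_mul_of_nonneg_left (hC (z, t) ⟨hz, Ioo_subset_Icc_self ht⟩) (norm_nonneg _)
  · exact (integrableOn_eulerKernel hX hY).norm.mul_const C
  · refine (ae_restrict_iff' measurableSet_Ioo).2 (.of_forall fun t ht z hz => ?_)
    have h1 := (((hasDerivAt_id z).mul_const (t : ℂ)).const_sub 1).cpow_const (c := Y - 1)
      (one_sub_mul_mem_slitPlane (hball hz) (Ioo_subset_Icc_self ht))
    simpa using h1.const_mul (eulerKernel X Y t)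

/-! ### Taylor coefficients and the Gauss series -/

theorem hasSum_one_sub_cpow (Y : ℂ) {w : ℂ} (hw : ‖w‖ < 1) :
    HasSum (fun n : ℕ => (ascPochhammer ℂ n).eval (1 - Y) / n.factorial * w ^ n)
      ((1 - w) ^ (Y - 1)) := by
  have h := (Complex.one_div_one_sub_cpow_hasFPowerSeriesOnBall_zero (1 - Y)).hasSum
    (y := w) (by simpa [enorm_eq_nnnorm, ← NNReal.coe_lt_one] using hw)
  convert! h using 1
  · ext n
    have h1 := Ring.factorial_nsmul_multichoose_eq_ascPochhammer (1 - Y) n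
    rw [Polynomial.ascPochhammer_smeval_eq_eval] at h1
    have h2 : Ring.choose (1 - Y + n - 1) n = Ring.multichoose (1 - Y) n := by
      rw [Ring.choose]; congr 1; ring
    have h3 : (n.factorial : ℂ) ≠ 0 := Nat.cast_ne_zero.2 n.factorial_ne_zero
    rw [FormalMultilinearSeries.ofScalars_apply_eq, h2, ← h1, smul_eq_mul, nsmul_eq_mul]
    field_simp
  · rw [zero_add, one_div, ← Complex.cpow_neg]
    congr 1
    ring

theorem hasSum_eulerIntegral {X Y : ℂ} (hX : ‖X‖ < 1) (hY : Y.re < 1) {z : ℂ} (hz : ‖z‖ < 1) :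
    HasSum (fun n : ℕ => (ascPochhammer ℂ n).eval (1 - Y) / n.factorial *
      (∫ t in Ioo (0 : ℝ) 1, eulerKernel X Y t * (t : ℂ) ^ n) * z ^ n)
      (eulerIntegral X Y z) := by
  have hφ := integrableOn_eulerKernel hX hY
  have hmeas := measurable_eulerKernel X Y
  let F (n : ℕ) (t : ℝ) : ℂ := eulerKernel X Y t *
    ((ascPochhammer ℂ n).eval (1 - Y) / n.factorial * (z * t) ^ n)
  have hbd (n : ℕ) (t : ℝ) (ht : t ∈ Ioo (0 : ℝ) 1) : ‖F n t‖ ≤ ‖eulerKernel X Y t‖ *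
      ‖(ascPochhammer ℂ n).eval (1 - Y) / n.factorial * (‖z‖ : ℂ) ^ n‖ := by
    simp only [F]
    rw [norm_mul, norm_mul, norm_mul _ (((‖z‖ : ℝ) : ℂ) ^ n), norm_pow, norm_pow, norm_mul,
      Complex.norm_real, Complex.norm_real, norm_norm, Real.norm_of_nonneg ht.1.le]
    gcongr
    · exact mul_nonneg (norm_nonneg z) ht.1.le
    · exact mul_le_of_le_one_right (norm_nonneg z) ht.2.le
  have hFi (n : ℕ) : IntegrableOn (F n) (Ioo 0 1) := by
    refine (hφ.norm.mul_const _).mono' (by fun_prop : Measurable (F n)).aestronglyMeasurable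
      ((ae_restrict_iff' measurableSet_Ioo).2 (.of_forall (hbd n)))
  have hsum : Summable fun n => ∫ t in Ioo (0 : ℝ) 1, ‖F n t‖ := by
    have h1 : Summable fun n : ℕ => ‖(ascPochhammer ℂ n).eval (1 - Y) / n.factorial *
        (‖z‖ : ℂ) ^ n‖ := (hasSum_one_sub_cpow Y (w := ‖z‖) (by simpa using hz)).summable.norm
    refine .of_nonneg_of_le (fun n => integral_nonneg fun t => norm_nonneg _) (fun n => ?_)
      (h1.mul_left (∫ t in Ioo (0 : ℝ) 1, ‖eulerKernel X Y t‖))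
    rw [← integral_mul_const]
    exact setIntegral_mono_on (hFi n).norm (hφ.norm.mul_const _) measurableSet_Ioo (hbd n)
  have h := hasSum_integral_of_summable_integral_norm hFi hsum
  convert! h using 1
  · ext n
    rw [← integral_const_mul, ← integral_mul_const]
    refine integral_congr_ae (.of_forall fun t => ?_)
    simp only [F, mul_pow]
    ring
  · refine setIntegral_congr_fun measurableSet_Ioo fun t ht => ?_
    have hzt : ‖z * t‖ < 1 := by
      rw [norm_mul, Complex.norm_real, Real.norm_of_nonneg ht.1.le]
      exact (mul_le_of_le_one_right (norm_nonneg _) ht.2.le).trans_lt hz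
    exact ((hasSum_one_sub_cpow Y hzt).mul_left _).tsum_eq.symm

/-- The integration by parts with s = -Y, a = 1-X+n, b = 1+n. The prefactors a+s and b+s cancel
against Γ(w+1) = w Γ(w) in the denominators of the beta values. Keeping -Y on the left avoids
dividing by Y, which may be 0. -/
theorem neg_mul_integral_eulerKernel_mul_pow {X Y : ℂ} (hX : ‖X‖ < 1) (hY : Y.re < 1)
    (hXY : ∀ k : ℕ, 1 - X - Y ≠ -k) (n : ℕ) :
    -Y * ∫ t in Ioo (0 : ℝ) 1, eulerKernel X Y t * (t : ℂ) ^ n =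
      Complex.Gamma (1 - Y) * (Complex.Gamma (1 - X + n) / Complex.Gamma (1 - X - Y + n) -
        n.factorial / Complex.Gamma (1 - Y + n)) := by
  have hXre : X.re < 1 := (Complex.re_le_norm X).trans_lt hX
  have hn : (0 : ℝ) ≤ n := n.cast_nonneg
  have ha : 0 < (1 - X + n).re := by simp; linarith
  have hb : 0 < (1 + n : ℂ).re := by simp; linarith
  have hs : -1 < (-Y).re := by simpa using hY
  have hs' : 0 < (-Y + 1).re := by simpa using hY
  have hf : ∀ t ∈ Ioo (0 : ℝ) 1, eulerKernel X Y t * (t : ℂ) ^ n =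
      (1 - t : ℂ) ^ (-Y - 1) * ((t : ℂ) ^ (1 - X + n - 1) - (t : ℂ) ^ (1 + n - 1 : ℂ)) := by
    intro t ht
    have ht0 : (t : ℂ) ≠ 0 := Complex.ofReal_ne_zero.2 ht.1.ne'
    rw [show 1 - X + n - 1 = -X + n by ring, add_sub_cancel_left, Complex.cpow_add _ _ ht0,
      Complex.cpow_natCast, eulerKernel]
    ring
  have hi : IntegrableOn (fun t : ℝ => eulerKernel X Y t * (t : ℂ) ^ n) (Ioo 0 1) := by
    refine (integrableOn_eulerKernel hX hY).mul_bdd (c := 1)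
      (by fun_prop : Measurable fun t : ℝ => (t : ℂ) ^ n).aestronglyMeasurable ?_
    refine (ae_restrict_iff' measurableSet_Ioo).2 (.of_forall fun t ht => ?_)
    rw [norm_pow, Complex.norm_real, Real.norm_of_nonneg ht.1.le]
    exact pow_le_one₀ ht.1.le ht.2.le
  have key := mul_integral_one_sub_cpow_mul_sub ha hb hs
    (hi.congr_fun hf measurableSet_Ioo)
  rw [setIntegral_congr_fun measurableSet_Ioo hf, key,
    Complex.betaIntegral_eq_Gamma_mul_div _ _ ha hs',
    Complex.betaIntegral_eq_Gamma_mul_div _ _ hb hs',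
    show 1 - X + n + (-Y + 1) = (1 - X - Y + n) + 1 by ring,
    show (1 + n : ℂ) + (-Y + 1) = (1 - Y + n) + 1 by ring,
    show 1 - X + n + -Y = 1 - X - Y + n by ring, show (1 + n : ℂ) + -Y = 1 - Y + n by ring]
  have h1 : 1 - X - Y + n ≠ 0 := by
    intro h; exact hXY n (by linear_combination h)
  have h2 : 0 < (1 - Y + n).re := by simp; linarith
  have h2' : 1 - Y + n ≠ 0 := by intro h; simp [h] at h2
  have h3 : Complex.Gamma (1 - X - Y + n) ≠ 0 := by
    refine Complex.Gamma_ne_zero fun m h => hXY (m + n) ?_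
    push_cast
    linear_combination h
  have h4 := Complex.Gamma_ne_zero_of_re_pos h2
  rw [Complex.Gamma_add_one _ h1, Complex.Gamma_add_one _ h2', add_comm (1 : ℂ) n,
    Complex.Gamma_nat_eq_factorial, show -Y + 1 = 1 - Y by ring]
  field_simp

theorem isGaussContinuation_eulerIntegral {X Y : ℂ} (hX : ‖X‖ < 1) (hY : Y.re < 1)
    (hXY : ∀ k : ℕ, 1 - X - Y ≠ -k) :
    IsGaussContinuation (1 - X) (1 - Y) (1 - X - Y) fun z =>
      Complex.Gamma (1 - X - Y) / (Complex.Gamma (1 - X) * Complex.Gamma (1 - Y)) *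
        ((1 - z)⁻¹ - Y * eulerIntegral X Y z) := by
  refine ⟨?_, fun z hz => ?_⟩
  · refine DifferentiableOn.const_mul (DifferentiableOn.sub ?_
      ((differentiableOn_eulerIntegral hX hY).const_mul Y)) _
    refine DifferentiableOn.inv (by fun_prop) fun z hz => ?_
    have h := one_sub_mul_mem_slitPlane hz (t := 1) (by simp)
    rw [Complex.ofReal_one, mul_one] at h
    exact Complex.slitPlane_ne_zero h
  · rw [mem_ball_zero_iff] at hz
    have hXre : X.re < 1 := (Complex.re_le_norm X).trans_lt hX
    have hX1 : ∀ k : ℕ, 1 - X ≠ -k := by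
      intro k h
      have := congrArg Complex.re h
      have hk : (0 : ℝ) ≤ k := k.cast_nonneg
      simp at this
      linarith
    have hY1 : ∀ k : ℕ, 1 - Y ≠ -k := by
      intro k h
      have := congrArg Complex.re h
      have hk : (0 : ℝ) ≤ k := k.cast_nonneg
      simp at this
      linarith
    have hsum := (((hasSum_geometric_of_norm_lt_one hz).sub
      ((hasSum_eulerIntegral hX hY hz).mul_left Y)).mul_left
      (Complex.Gamma (1 - X - Y) / (Complex.Gamma (1 - X) * Complex.Gamma (1 - Y))))
    rw [ordinaryHypergeometric_eq_tsum]
    refine hsum.tsum_eq.symm.trans ?_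
    refine tsum_congr fun n => ?_
    have hm := neg_mul_integral_eulerKernel_mul_pow hX hY hXY n
    set M := ∫ t in Ioo (0 : ℝ) 1, eulerKernel X Y t * (t : ℂ) ^ n
    have g1 := Complex.Gamma_ne_zero hX1
    have g2 := Complex.Gamma_ne_zero hY1
    have g3 := Complex.Gamma_ne_zero hXY
    have g4 : Complex.Gamma (1 - Y + n) ≠ 0 := by
      refine Complex.Gamma_ne_zero fun m h => hY1 (m + n) ?_
      push_cast
      linear_combination h
    have g5 : Complex.Gamma (1 - X - Y + n) ≠ 0 := by
      refine Complex.Gamma_ne_zero fun m h => hXY (m + n) ?_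
      push_cast
      linear_combination h
    have hfac : (n.factorial : ℂ) ≠ 0 := Nat.cast_ne_zero.2 n.factorial_ne_zero
    rw [← Complex.Gamma_add_nat_div_Gamma_eq _ hX1, ← Complex.Gamma_add_nat_div_Gamma_eq _ hY1,
      ← Complex.Gamma_add_nat_div_Gamma_eq _ hXY, smul_eq_mul]
    -- Written this way, the 1 from the geometric series cancels the n!/Γ(1-Y+n) term of the moment,
    -- leaving exactly the Gauss coefficient.
    have hrw : z ^ n - Y * (Complex.Gamma (1 - Y + n) / Complex.Gamma (1 - Y) / n.factorial * M *
        z ^ n) = z ^ n * (1 + Complex.Gamma (1 - Y + n) / Complex.Gamma (1 - Y) / n.factorial *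
        (-Y * M)) := by ring
    rw [hrw, hm]
    field_simp
    ring

/-! ### The generating function -/

theorem hasSum_pow_div_factorial (x : ℂ) :
    HasSum (fun n : ℕ => x ^ n / n.factorial) (Complex.exp x) := by
  rw [Complex.exp_eq_exp_ℂ]
  exact NormedSpace.expSeries_div_hasSum_exp x

theorem hasSum_pow_succ_div_factorial (x : ℂ) :
    HasSum (fun n : ℕ => x ^ (n + 1) / (n + 1).factorial) (Complex.exp x - 1) := by
  simpa using (hasSum_nat_add_iff' 1).2 (hasSum_pow_div_factorial x)

theorem hasSum_mul {ι κ : Type*} {f : ι → ℂ} {g : κ → ℂ} {a b : ℂ} (hf : HasSum f a)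
    (hg : HasSum g b) : HasSum (fun p : ι × κ => f p.1 * g p.2) (a * b) :=
  hf.mul hg (summable_mul_of_summable_norm hf.summable.norm hg.summable.norm)

theorem hasSum_kernel (c : ℝ) (X Y : ℂ) {t : ℝ} (ht : t ∈ Ioo (0 : ℝ) 1) :
    HasSum (fun p : ℕ × ℕ => (kernel c (p.1 + 1) p.2 t : ℂ) * X ^ (p.1 + 1) * Y ^ (p.2 + 1))
      (omega c 1 t * ((t : ℂ) ^ (-X) - 1) * (Y * Complex.exp (primitive c t * Y))) := by
  have h1 := hasSum_pow_succ_div_factorial (Complex.log t * -X)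
  have h2 := hasSum_pow_div_factorial (primitive c t * Y)
  rw [← Complex.cpow_def_of_ne_zero (Complex.ofReal_ne_zero.2 ht.1.ne')] at h1
  have h := (hasSum_mul h1 h2).mul_left ((omega c 1 t : ℂ) * Y)
  rw [show (omega c 1 t * ((t : ℂ) ^ (-X) - 1) * (Y * Complex.exp (primitive c t * Y)) : ℂ) =
    omega c 1 t * Y * (((t : ℂ) ^ (-X) - 1) * Complex.exp (primitive c t * Y)) by ring]
  refine h.congr_fun fun p => ?_
  rw [kernel, ← neg_mul_comm, ← Complex.ofReal_log ht.1.le, mul_pow, mul_pow]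
  push_cast
  ring

/-- The exponential of Y P(t) is ((1-ct)/(1-t))^Y, and the denominator of ω₁ lowers both exponents
by one. -/
theorem generating_eq {c : ℝ} (hc : c < 1) (X Y : ℂ) {t : ℝ} (ht : t ∈ Ioo (0 : ℝ) 1) :
    omega c 1 t * ((t : ℂ) ^ (-X) - 1) * (Y * Complex.exp (primitive c t * Y)) =
      (1 - c) * Y * (eulerKernel X Y t * (1 - c * t) ^ (Y - 1)) := by
  have h1 := one_sub_mul_pos hc ht.1.le ht.2
  have h2 : 0 < 1 - t := sub_pos.2 ht.2
  have h1' : (1 - c * t : ℂ) ≠ 0 := by exact_mod_cast h1.ne'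
  have h2' : (1 - t : ℂ) ≠ 0 := by exact_mod_cast h2.ne'
  have h3 : Complex.exp (primitive c t * Y) = (1 - c * t : ℂ) ^ Y * (1 - t : ℂ) ^ (-Y) := by
    rw [Complex.cpow_def_of_ne_zero h1', Complex.cpow_def_of_ne_zero h2', ← Complex.exp_add,
      primitive, Complex.ofReal_sub, Complex.ofReal_log h1.le, Complex.ofReal_log h2.le]
    push_cast
    ring_nf
  rw [h3, eulerKernel, Complex.cpow_sub _ _ h1', Complex.cpow_sub _ _ h2', Complex.cpow_one,
    Complex.cpow_one]
  simp only [omega, one_ne_zero, if_false]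
  push_cast
  field_simp

/-- For nonnegative terms an integrable pointwise sum dominates each term and every finite partial
sum; this yields convergence of the individual integrals and of their series at once. -/
theorem integrable_and_summable_of_hasSum {α ι : Type*} [MeasurableSpace α] {μ : Measure α}
    {F : ι → α → ℝ} {S : α → ℝ} (hm : ∀ i, AEStronglyMeasurable (F i) μ)
    (h0 : ∀ᵐ x ∂μ, ∀ i, 0 ≤ F i x) (hF : ∀ᵐ x ∂μ, HasSum (F · x) (S x)) (hS : Integrable S μ) :
    (∀ i, Integrable (F i) μ) ∧ Summable fun i => ∫ x, F i x ∂μ := by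
  have hi (i : ι) : Integrable (F i) μ := by
    refine hS.mono' (hm i) ?_
    filter_upwards [h0, hF] with x hx hx'
    rw [Real.norm_of_nonneg (hx i)]
    exact le_hasSum hx' i fun j _ => hx j
  refine ⟨hi, summable_of_sum_le (c := ∫ x, S x ∂μ) (fun i => integral_nonneg_of_ae ?_) fun u => ?_⟩
  · filter_upwards [h0] with x hx using hx i
  · rw [← integral_finsetSum _ fun i _ => hi i]
    refine integral_mono_ae (integrable_finsetSum _ fun i _ => hi i) hS ?_
    filter_upwards [h0, hF] with x hx hx'
    exact sum_le_hasSum u (fun j _ => hx j) hx'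

theorem ofReal_mem_cutPlane {c : ℝ} (hc : c < 1) : (c : ℂ) ∈ cutPlane := Or.inl (by simpa using hc)

theorem integrable_and_summable_kernel {c : ℝ} (hc : c < 1) {x y : ℝ} (hx0 : 0 ≤ x) (hx : x < 1)
    (hy0 : 0 ≤ y) (hy : y < 1) :
    (∀ p : ℕ × ℕ, IntegrableOn (fun t => kernel c (p.1 + 1) p.2 t * x ^ (p.1 + 1) * y ^ (p.2 + 1))
      (Ioo 0 1)) ∧
    Summable fun p : ℕ × ℕ =>
      ∫ t in Ioo (0 : ℝ) 1, kernel c (p.1 + 1) p.2 t * x ^ (p.1 + 1) * y ^ (p.2 + 1) := by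
  -- The sum of the real series is expressed as a real part, so that integrability is inherited from
  -- the complex Euler integrand.
  have hS : IntegrableOn (fun t : ℝ => (omega c 1 t * ((t : ℂ) ^ (-(x : ℂ)) - 1) *
      (y * Complex.exp (primitive c t * y))).re) (Ioo 0 1) := by
    refine Integrable.re (𝕜 := ℂ) (f := fun t : ℝ => (omega c 1 t * ((t : ℂ) ^ (-(x : ℂ)) - 1) *
      (y * Complex.exp (primitive c t * y)) : ℂ)) ?_
    refine IntegrableOn.congr_fun ?_ (fun t ht => (generating_eq hc x y ht).symm) measurableSet_Ioo
    exact (integrableOn_eulerKernel_mul (by simpa [abs_of_nonneg hx0] using hx)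
      (by simpa using hy) _ (ofReal_mem_cutPlane hc)).const_mul _
  refine integrable_and_summable_of_hasSum (fun p => ?_) ?_ ?_ hS
  · exact (((measurable_kernel c _ _).mul_const _).mul_const _).aestronglyMeasurable
  · refine (ae_restrict_iff' measurableSet_Ioo).2 (.of_forall fun t ht p => ?_)
    have := kernel_nonneg hc (p.1 + 1) p.2 ht
    positivity
  · refine (ae_restrict_iff' measurableSet_Ioo).2 (.of_forall fun t ht => ?_)
    have h := Complex.hasSum_re (hasSum_kernel c x y ht)
    convert! h using 2 with p
    norm_cast

theorem integrableOn_kernel {c : ℝ} (hc : c < 1) (m n : ℕ) :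
    IntegrableOn (kernel c (m + 1) n) (Ioo 0 1) := by
  -- Any x, y in (0, 1) would do: one term of the convergent family is a nonzero multiple of the
  -- kernel.
  have h := (integrable_and_summable_kernel hc (x := 1 / 2) (y := 1 / 2) (by norm_num)
    (by norm_num) (by norm_num) (by norm_num)).1 (m, n)
  refine ((h.mul_const (2 ^ (n + 1))).mul_const (2 ^ (m + 1))).congr (.of_forall fun t => ?_)
  simp only [one_div, inv_pow]
  field_simp

theorem hasSum_Z {c : ℝ} (hc : c < 1) {X Y : ℂ} (hX : ‖X‖ < 1) (hY : ‖Y‖ < 1) :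
    HasSum (fun p : ℕ × ℕ =>
      (Z c (List.replicate p.2 1 ++ [p.1 + 2]) : ℂ) * X ^ (p.1 + 1) * Y ^ (p.2 + 1))
      ((1 - c) * Y * eulerIntegral X Y c) := by
  have hs := (integrable_and_summable_kernel hc (norm_nonneg X) hX (norm_nonneg Y) hY).2
  have hi (p : ℕ × ℕ) : IntegrableOn (fun t : ℝ =>
      (kernel c (p.1 + 1) p.2 t : ℂ) * X ^ (p.1 + 1) * Y ^ (p.2 + 1)) (Ioo 0 1) :=
    ((integrableOn_kernel hc p.1 p.2).ofReal.mul_const _).mul_const _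
  have h := hasSum_integral_of_summable_integral_norm hi ?_
  · convert! h using 1
    · ext p
      rw [Z_eq_integral_kernel hc (p.1 + 1) p.2, integral_mul_const, integral_mul_const,
        integral_complex_ofReal]
    · rw [eulerIntegral, ← integral_const_mul]
      refine setIntegral_congr_fun measurableSet_Ioo fun t ht => ?_
      exact (generating_eq hc X Y ht).symm.trans (hasSum_kernel c X Y ht).tsum_eq.symm
  -- The norm of the term at (X, Y) is the term at (|X|, |Y|), by nonnegativity of the kernel.
  · convert! hs using 2 with p
    refine setIntegral_congr_fun measurableSet_Ioo fun t ht => ?_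
    simp [abs_of_nonneg (kernel_nonneg hc (p.1 + 1) p.2 ht)]

end DeformedMZV

end

/-- The pair `p = (m - 1, n - 1)` runs over `ℕ × ℕ`, i.e. `m = p.1 + 1` and `n = p.2 + 1` run over
the positive integers. -/
theorem mainTheorem1 (c : ℝ) (hc : c < 1) :
    (∀ m n : ℕ, 1 ≤ m → 1 ≤ n →
      MeasureTheory.IntegrableOn
        (DeformedMZV.integrand c (DeformedMZV.wordOf (List.replicate (n - 1) 1 ++ [m + 1])))
        (DeformedMZV.openSimplex
          (DeformedMZV.wordOf (List.replicate (n - 1) 1 ++ [m + 1])).length)) ∧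
    ∀ X Y : ℂ, ‖X‖ < 1 → ‖Y‖ < 1 → X + Y ≠ 1 →
      Summable (fun p : ℕ × ℕ =>
        (DeformedMZV.Z c (List.replicate p.2 1 ++ [p.1 + 2]) : ℂ) *
          X ^ (p.1 + 1) * Y ^ (p.2 + 1)) ∧
      1 - ∑' p : ℕ × ℕ,
        (DeformedMZV.Z c (List.replicate p.2 1 ++ [p.1 + 2]) : ℂ) *
          X ^ (p.1 + 1) * Y ^ (p.2 + 1) =
      (1 - (c : ℂ)) *
        (Complex.Gamma (1 - X) * Complex.Gamma (1 - Y) / Complex.Gamma (1 - X - Y)) *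
        DeformedMZV.gaussHypergeometric (1 - X) (1 - Y) (1 - X - Y) (c : ℂ) := by
  refine ⟨fun m n hm hn => ?_, fun X Y hX hY hXY => ?_⟩
  · obtain ⟨m, rfl⟩ := Nat.exists_eq_add_of_le' hm
    exact DeformedMZV.integrableOn_integrand hc (DeformedMZV.integrableOn_kernel hc m (n - 1))
  · have h := DeformedMZV.hasSum_Z hc hX hY
    refine ⟨h.summable, ?_⟩
    have hXre : X.re < 1 := (Complex.re_le_norm X).trans_lt hX
    have hYre : Y.re < 1 := (Complex.re_le_norm Y).trans_lt hY
    have hd : ∀ k : ℕ, 1 - X - Y ≠ -k := by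
      rintro (_ | k) hk
      · exact hXY (by linear_combination -hk - (Nat.cast_zero (R := ℂ)))
      · have h1 := congrArg Complex.re hk
        have h2 : (0 : ℝ) ≤ k := k.cast_nonneg
        simp at h1
        linarith
    have g1 : Complex.Gamma (1 - X) ≠ 0 := Complex.Gamma_ne_zero_of_re_pos (by simpa using hXre)
    have g2 : Complex.Gamma (1 - Y) ≠ 0 := Complex.Gamma_ne_zero_of_re_pos (by simpa using hYre)
    have g3 := Complex.Gamma_ne_zero hd
    have hc' : (1 - c : ℂ) ≠ 0 := by exact_mod_cast (sub_pos.2 hc).ne'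
    rw [h.tsum_eq, DeformedMZV.gaussHypergeometric_eq
      (DeformedMZV.isGaussContinuation_eulerIntegral hX hYre hd)
      (DeformedMZV.ofReal_mem_cutPlane hc)]
    field_simp
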